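/- Let $0\le r\le n$ be integers, $\mathbb X\subset\mathbb R^n$ Lebesgue measurable and $\mathbb Z\subset\mathbb R^r$ Borel measurable (e.g. a domain), and write $|\mathbb Z|$ for its Lebesgue measure (with $1/\infty=0$). Consider a continuous-time Markov process on $\mathbb X$ with measurable transition densities $p^t:\mathbb X\times\mathbb X\to[0,\infty)$, $t>0$, i.e. $P^t(x,B)=\int_{B\cap\mathbb X}p^t(x,y)\,dy$ are probability measures satisfying the Chapman--Kolmogorov equation. Assume that it has a unique stationary probability measure $\mu$, that $\mu$ has a continuous, strictly positive Lebesgue density $\pi$ on $\mathbb X$, and that $p^t(x,y)\pi(x)=p^t(y,x)\pi(y)$ for all $x,y\in\mathbb X$, $t>0$. A reaction coordinate is a map $\xi$ from $\mathbb R^n$ to $\mathbb R^r$ that is continuous on $\mathbb X$, maps $\mathbb X$ into $\mathbb Z$, and at almost every point of $\mathbb X$ is differentiable with derivative $\nabla\xi(x)^{\top}$ of full rank $r$. For $z\in\mathbb Z$ let $\Sigma_\xi(z)=\{x\in\mathbb X:\xi(x)=z\}$ and define on $\Sigma_\xi(z)$ the measures $$d\sigma^\xi_z=\det\big(\nabla\xi^{\top}\nabla\xi\big)^{-1/2}\,dH_{n-r},\qquad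 d\mu^\xi_z=\pi\,d\sigma^\xi_z ,$$ where $H_{n-r}$ is the $(n-r)$-dimensional Hausdorff measure (normalized to agree with Lebesgue measure on $\mathbb R^{n-r}$), and the weight is understood to be $0$ where $\xi$ is not differentiable with full rank. Let $\xi$ and $\vartheta$ be reaction coordinates, and let the process be $\varepsilon$-lumpable ($\varepsilon\ge 0$) with respect to $\xi$ with lag time $\tau>0$ and effective densities $p_L^t:\mathbb Z\times\mathbb X\to[0,\infty)$, i.e. the $p_L^t$ are measurable and $$\frac1{|\mathbb Z|}\int_{\mathbb X}\int_{\mathbb X}\big|p^t(x,y)-p_L^t(\xi(x),y)\big|\,dy\,d\mu(x)\le\varepsilon\qquad\text{for all }t\ge\tau .$$ With $p_L=p_L^\tau$, define $$f_L(z)=\frac1{|\mathbb Z|}\int_{\mathbb Z}\int_{\Sigma_\vartheta(z')}\int_{\Sigma_\vartheta(z')}\left|\frac{p_L(z,y_1)}{\pi(y_1)}-\frac{p_L(z,y_2)}{\pi(y_2)}\right|d\mu^\vartheta_{z'}(y_1)\,d\mu^\vartheta_{z'}(y_2)\,dz'$$ (set to $0$ where this is infinite), and let $\bar\mu$ be the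 measure on $\mathbb Z$ with Lebesgue density $\bar\pi(z)=\int_{\Sigma_\xi(z)}\pi\,d\sigma^\xi_z$. Then $\bar\mu$ is a probability measure, $f_L\circ\xi\in L^2(\mu)$ if and only if $f_L\in L^2(\bar\mu)$, and $$\operatorname{Var}_\mu(f_L\circ\xi)=\operatorname{Var}_{\bar\mu}(f_L),$$ where $\operatorname{Var}_\nu(g)=\int (g-\int g\,d\nu)^2\,d\nu$ if $g\in L^2(\nu)$ (and, by convention, $\operatorname{Var}_\nu(g)=0$ otherwise). -/

import Mathlib

open MeasureTheory
open scoped ENNReal NNReal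

namespace ReactionCoordinate

noncomputable section

variable {n r : ℕ}

/-- The measure `μ` on the state space `X ⊆ ℝⁿ` with Lebesgue density `π`
(a Borel measure on `ℝⁿ` that is carried by `X`). -/
def stationaryMeasure (X : Set (EuclideanSpace ℝ (Fin n))) (π : EuclideanSpace ℝ (Fin n) → ℝ) :
    Measure (EuclideanSpace ℝ (Fin n)) :=
  (volume.restrict X).withDensity fun x => ENNReal.ofReal (π x)

/-- The transition probability `Pᵗ(x, ·)`, with density `pᵗ(x, ·)` on `X`. -/
def transitionMeasure (X : Set (EuclideanSpace ℝ (Fin n)))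
    (p : ℝ → EuclideanSpace ℝ (Fin n) → EuclideanSpace ℝ (Fin n) → ℝ) (t : ℝ)
    (x : EuclideanSpace ℝ (Fin n)) : Measure (EuclideanSpace ℝ (Fin n)) :=
  (volume.restrict X).withDensity fun y => ENNReal.ofReal (p t x y)

/-- `ν` is stationary for the transition function with densities `pᵗ`. -/
def IsStationary (X : Set (EuclideanSpace ℝ (Fin n)))
    (p : ℝ → EuclideanSpace ℝ (Fin n) → EuclideanSpace ℝ (Fin n) → ℝ)
    (ν : Measure (EuclideanSpace ℝ (Fin n))) : Prop :=
  ∀ t : ℝ, 0 < t → ∀ B : Set (EuclideanSpace ℝ (Fin n)), MeasurableSet B →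
    ∫⁻ x in X, transitionMeasure X p t x B ∂ν = ν B

/-- A continuous-time Markov process on the Lebesgue-measurable set `X ⊆ ℝⁿ`, given by its
transition densities `pᵗ`, `t > 0`, which is reversible with respect to a continuous and strictly
positive density `π`, the density of its unique stationary probability measure.
Only the values of `π` on `X` and of `pᵗ` on `X × X` are constrained. -/
structure IsReversibleSystem (X : Set (EuclideanSpace ℝ (Fin n)))
    (π : EuclideanSpace ℝ (Fin n) → ℝ)
    (p : ℝ → EuclideanSpace ℝ (Fin n) → EuclideanSpace ℝ (Fin n) → ℝ) : Prop where
  nullMeasurableSet : NullMeasurableSet X volume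
  continuousOn_density : ContinuousOn π X
  density_pos : ∀ x ∈ X, 0 < π x
  isProbabilityMeasure : IsProbabilityMeasure (stationaryMeasure X π)
  measurable_transition : ∀ t : ℝ, 0 < t → Measurable fun q : X × X => p t q.1 q.2
  transition_nonneg : ∀ t : ℝ, 0 < t → ∀ x ∈ X, ∀ y ∈ X, 0 ≤ p t x y
  transition_prob : ∀ t : ℝ, 0 < t → ∀ x ∈ X, IsProbabilityMeasure (transitionMeasure X p t x)
  chapman_kolmogorov : ∀ s t : ℝ, 0 < s → 0 < t → ∀ x ∈ X,
    ∀ B : Set (EuclideanSpace ℝ (Fin n)), MeasurableSet B →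
      transitionMeasure X p (s + t) x B =
        ∫⁻ u in X, transitionMeasure X p t u B ∂(transitionMeasure X p s x)
  stationary_unique : ∀ ν : Measure (EuclideanSpace ℝ (Fin n)), IsProbabilityMeasure ν →
    ν Xᶜ = 0 → (IsStationary X p ν ↔ ν = stationaryMeasure X π)
  detailed_balance : ∀ t : ℝ, 0 < t → ∀ x ∈ X, ∀ y ∈ X, p t x y * π x = p t y x * π y

/-- A reaction coordinate: a continuous map from `X` to `Z ⊆ ℝʳ` whose derivative exists and has
full rank `r` at almost every point of `X`. -/
structure IsReactionCoordinate (X : Set (EuclideanSpace ℝ (Fin n)))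
    (Z : Set (EuclideanSpace ℝ (Fin r)))
    (ξ : EuclideanSpace ℝ (Fin n) → EuclideanSpace ℝ (Fin r)) : Prop where
  continuousOn : ContinuousOn ξ X
  mapsTo : Set.MapsTo ξ X Z
  regular : ∀ᵐ x ∂(volume.restrict X),
    DifferentiableAt ℝ ξ x ∧ Function.Surjective (fderiv ℝ ξ x)

/-- The level set `{x ∈ X | ξ(x) = z}`. -/
def levelSet (X : Set (EuclideanSpace ℝ (Fin n)))
    (ξ : EuclideanSpace ℝ (Fin n) → EuclideanSpace ℝ (Fin r)) (z : EuclideanSpace ℝ (Fin r)) :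
    Set (EuclideanSpace ℝ (Fin n)) :=
  {x | x ∈ X ∧ ξ x = z}

/-- The factor `det(∇ξ(x)ᵀ ∇ξ(x))^(-1/2)`, where `∇ξ(x)ᵀ` is the derivative of `ξ` at `x`.
It is `0` at the points where the determinant vanishes. -/
def coareaWeight (ξ : EuclideanSpace ℝ (Fin n) → EuclideanSpace ℝ (Fin r))
    (x : EuclideanSpace ℝ (Fin n)) : ℝ :=
  (Real.sqrt (fderiv ℝ ξ x ∘L ContinuousLinearMap.adjoint (fderiv ℝ ξ x)).det)⁻¹

/-- The surface measure `dσ_z = det(∇ξᵀ ∇ξ)^(-1/2) dH_{n-r}` on the `z`-level set of `ξ`;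
`μHE[d]` is the `d`-dimensional Hausdorff measure, normalized to be Lebesgue measure on `ℝᵈ`. -/
def surfaceMeasure (X : Set (EuclideanSpace ℝ (Fin n)))
    (ξ : EuclideanSpace ℝ (Fin n) → EuclideanSpace ℝ (Fin r)) (z : EuclideanSpace ℝ (Fin r)) :
    Measure (EuclideanSpace ℝ (Fin n)) :=
  (μHE[n - r].restrict (levelSet X ξ z)).withDensity fun x => ENNReal.ofReal (coareaWeight ξ x)

/-- The marginal stationary measure `dμ_z = π dσ_z` on the `z`-level set of `ξ`. -/
def marginalMeasure (X : Set (EuclideanSpace ℝ (Fin n))) (π : EuclideanSpace ℝ (Fin n) → ℝ)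
    (ξ : EuclideanSpace ℝ (Fin n) → EuclideanSpace ℝ (Fin r)) (z : EuclideanSpace ℝ (Fin r)) :
    Measure (EuclideanSpace ℝ (Fin n)) :=
  (surfaceMeasure X ξ z).withDensity fun x => ENNReal.ofReal (π x)

/-- The effective invariant density `π̄(z) = ∫_{Σ_ξ(z)} π dσ_z`. -/
def effectiveDensity (X : Set (EuclideanSpace ℝ (Fin n))) (π : EuclideanSpace ℝ (Fin n) → ℝ)
    (ξ : EuclideanSpace ℝ (Fin n) → EuclideanSpace ℝ (Fin r)) (z : EuclideanSpace ℝ (Fin r)) :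
    ℝ≥0∞ :=
  ∫⁻ x, ENNReal.ofReal (π x) ∂(surfaceMeasure X ξ z)

/-- The effective measure `μ̄` on `Z`, with Lebesgue density `π̄`. -/
def effectiveMeasure (X : Set (EuclideanSpace ℝ (Fin n))) (Z : Set (EuclideanSpace ℝ (Fin r)))
    (π : EuclideanSpace ℝ (Fin n) → ℝ)
    (ξ : EuclideanSpace ℝ (Fin n) → EuclideanSpace ℝ (Fin r)) :
    Measure (EuclideanSpace ℝ (Fin r)) :=
  (volume.restrict Z).withDensity (effectiveDensity X π ξ)

/-- The system with transition densities `pᵗ` is `ε`-lumpable with respect to `ξ`, with lag time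
`τ` and effective densities `p_Lᵗ : Z × X → ℝ⁺`: for all `t ≥ τ`,
`|Z|⁻¹ ∫_X ∫_X |pᵗ(x,y) - p_Lᵗ(ξ(x),y)| dy dμ(x) ≤ ε`. -/
structure IsLumpable (X : Set (EuclideanSpace ℝ (Fin n))) (Z : Set (EuclideanSpace ℝ (Fin r)))
    (π : EuclideanSpace ℝ (Fin n) → ℝ)
    (p : ℝ → EuclideanSpace ℝ (Fin n) → EuclideanSpace ℝ (Fin n) → ℝ)
    (ξ : EuclideanSpace ℝ (Fin n) → EuclideanSpace ℝ (Fin r)) (ε : ℝ≥0) (τ : ℝ)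
    (pL : ℝ → EuclideanSpace ℝ (Fin r) → EuclideanSpace ℝ (Fin n) → ℝ) : Prop where
  lag_pos : 0 < τ
  measurable : ∀ t : ℝ, τ ≤ t → Measurable fun q : Z × X => pL t q.1 q.2
  nonneg : ∀ t : ℝ, τ ≤ t → ∀ z ∈ Z, ∀ y ∈ X, 0 ≤ pL t z y
  bound : ∀ t : ℝ, τ ≤ t →
    (volume Z)⁻¹ *
      ∫⁻ x, (∫⁻ y in X, ENNReal.ofReal |p t x y - pL t (ξ x) y|) ∂(stationaryMeasure X π)
      ≤ (ε : ℝ≥0∞)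

/-- The function
`f_L(z) = |Z|⁻¹ ∫_Z ∫_{Σ_ϑ(z')} ∫_{Σ_ϑ(z')}
  |p_L(z,y₁)/π(y₁) - p_L(z,y₂)/π(y₂)| dμ_{z'}(y₁) dμ_{z'}(y₂) dz'`
(with value `0` at those `z` for which the integral is infinite). -/
def effectiveIntegrand (X : Set (EuclideanSpace ℝ (Fin n))) (Z : Set (EuclideanSpace ℝ (Fin r)))
    (π : EuclideanSpace ℝ (Fin n) → ℝ)
    (ϑ : EuclideanSpace ℝ (Fin n) → EuclideanSpace ℝ (Fin r))
    (pL : EuclideanSpace ℝ (Fin r) → EuclideanSpace ℝ (Fin n) → ℝ)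
    (z : EuclideanSpace ℝ (Fin r)) : ℝ :=
  ((volume Z)⁻¹ *
    ∫⁻ z' in Z, ∫⁻ y₂, ∫⁻ y₁, ENNReal.ofReal |pL z y₁ / π y₁ - pL z y₂ / π y₂|
      ∂(marginalMeasure X π ϑ z') ∂(marginalMeasure X π ϑ z')).toReal

end

end ReactionCoordinate

/-!
Let `μ` be the stationary measure. The coarea formula for `ξ`, applied to the density of `μ`,
says that the effective measure `μ̄` is the image of `μ` under `ξ`; moments and variances with
respect to `μ̄` and `μ` then agree by the change of variables formula.

For the coarea formula, the set of regular points is cut into countably many pieces on which `ξ` is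
so close to a surjective linear map `A` that, for `c > 1`, both sides agree up to a factor `c` with
their values for `A`, where the formula is Fubini's theorem; then `c → 1`.

The integrand `f_L` need not be measurable. The change of variables nevertheless applies to it,
because `μ` disintegrates along `ξ` into probability measures carried by the fibers, on which
`f_L ∘ ξ` is constant.
-/

namespace ReactionCoordinate

open Filter Topology Module
open scoped InnerProduct

section Factor

/-- `a` and `b` agree up to the multiplicative error `c`. Local linear approximation computes
measures only up to such an error, which is then sent to `1`. -/
def EqUpToFactor (c : ℝ≥0) (a b : ℝ≥0∞) : Prop :=
  a ≤ c * b ∧ b ≤ c * a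

variable {c c' : ℝ≥0} {a b d : ℝ≥0∞}

lemma EqUpToFactor.symm (h : EqUpToFactor c a b) : EqUpToFactor c b a :=
  ⟨h.2, h.1⟩

lemma EqUpToFactor.mono (h : EqUpToFactor c a b) (hc : c ≤ c') : EqUpToFactor c' a b :=
  ⟨h.1.trans (by gcongr), h.2.trans (by gcongr)⟩

lemma EqUpToFactor.trans (hab : EqUpToFactor c a b) (hbd : EqUpToFactor c' b d) :
    EqUpToFactor (c * c') a d := by
  rw [EqUpToFactor, ENNReal.coe_mul]
  constructor
  · calc a ≤ c * b := hab.1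
      _ ≤ c * (c' * d) := by gcongr; exact hbd.1
      _ = c * c' * d := (mul_assoc _ _ _).symm
  · calc d ≤ c' * b := hbd.2
      _ ≤ c' * (c * a) := by gcongr; exact hab.2
      _ = c * c' * a := by ring

lemma EqUpToFactor.tsum {ι : Type*} {a b : ι → ℝ≥0∞} (h : ∀ i, EqUpToFactor c (a i) (b i)) :
    EqUpToFactor c (∑' i, a i) (∑' i, b i) := by
  simp only [EqUpToFactor, ← ENNReal.tsum_mul_left]
  exact ⟨ENNReal.tsum_le_tsum fun i => (h i).1, ENNReal.tsum_le_tsum fun i => (h i).2⟩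

lemma EqUpToFactor.lintegral {α : Type*} [MeasurableSpace α] {μ : Measure α} {f g : α → ℝ≥0∞}
    (h : ∀ᵐ x ∂μ, EqUpToFactor c (f x) (g x)) :
    EqUpToFactor c (∫⁻ x, f x ∂μ) (∫⁻ x, g x ∂μ) := by
  simp only [EqUpToFactor, ← lintegral_const_mul' _ _ ENNReal.coe_ne_top]
  exact ⟨lintegral_mono_ae (h.mono fun x hx => hx.1), lintegral_mono_ae (h.mono fun x hx => hx.2)⟩

lemma tendsto_of_eqUpToFactor {ι : Type*} {l : Filter ι} {u : ι → ℝ≥0} (hu : Tendsto u l (𝓝 1))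
    {a : ι → ℝ≥0∞} (h : ∀ i, EqUpToFactor (u i) (a i) b) : Tendsto a l (𝓝 b) := by
  have hu' : Tendsto (fun i => (u i : ℝ≥0∞)) l (𝓝 1) := ENNReal.tendsto_coe.2 hu
  have hlower : Tendsto (fun i => b / u i) l (𝓝 b) := by
    simpa using ENNReal.Tendsto.div tendsto_const_nhds (Or.inr one_ne_zero) hu'
      (Or.inl ENNReal.one_ne_top) (a := b)
  have hupper : Tendsto (fun i => (u i : ℝ≥0∞) * b) l (𝓝 b) := by
    simpa using ENNReal.Tendsto.mul_const hu' (Or.inl one_ne_zero) (b := b)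
  exact tendsto_of_tendsto_of_tendsto_of_le_of_le hlower hupper
    (fun i => ENNReal.div_le_of_le_mul' (h i).2) fun i => (h i).1

lemma eq_of_forall_eqUpToFactor {ι : Type*} {l : Filter ι} [NeBot l] {u : ι → ℝ≥0}
    (hu : Tendsto u l (𝓝 1)) (h : ∀ i, EqUpToFactor (u i) a b) : a = b :=
  tendsto_nhds_unique tendsto_const_nhds (tendsto_of_eqUpToFactor hu h)

end Factor

section Linear

variable {E F G : Type*}
  [NormedAddCommGroup E] [InnerProductSpace ℝ E] [FiniteDimensional ℝ E]
  [NormedAddCommGroup F] [InnerProductSpace ℝ F] [FiniteDimensional ℝ F]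
  [NormedAddCommGroup G] [InnerProductSpace ℝ G] [FiniteDimensional ℝ G]

/-- The Jacobian `det(A Aᵀ)^(1/2)` of the coarea formula: the factor by which `A` scales volumes on
the orthogonal complement of its kernel. -/
noncomputable def coareaJacobian (A : E →L[ℝ] F) : ℝ :=
  √(A ∘L A†).det

lemma coareaJacobian_eq_normDet_adjoint (A : E →L[ℝ] F) :
    coareaJacobian A = (A†).toLinearMap.normDet := by
  have h := (A†).normDet_sq
  rw [ContinuousLinearMap.adjoint_adjoint] at h
  rw [coareaJacobian, ← h]
  exact Real.sqrt_sq (LinearMap.normDet_nonneg _)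

lemma coareaJacobian_pos_iff {A : E →L[ℝ] F} :
    0 < coareaJacobian A ↔ Function.Surjective A := by
  rw [coareaJacobian_eq_normDet_adjoint, (LinearMap.normDet_nonneg _).lt_iff_ne', ne_eq,
    LinearMap.normDet_eq_zero_iff_ker_ne_bot, not_not, ← ContinuousLinearMap.orthogonal_range,
    Submodule.orthogonal_eq_bot_iff]
  exact LinearMap.range_eq_top

lemma continuous_coareaJacobian : Continuous (coareaJacobian : (E →L[ℝ] F) → ℝ) :=
  (ContinuousLinearMap.continuous_det.comp
    (continuous_id.clm_comp ContinuousLinearMap.adjoint.continuous)).sqrt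

omit [FiniteDimensional ℝ F] in
lemma exists_linearIsometry_range_eq_ker {A : E →L[ℝ] F} (hA : Function.Surjective A) :
    ∃ i : EuclideanSpace ℝ (Fin (finrank ℝ E - finrank ℝ F)) →ₗᵢ[ℝ] E,
      i.toLinearMap.range = A.ker := by
  have hker : finrank ℝ A.ker = finrank ℝ E - finrank ℝ F := by
    have h := A.toLinearMap.finrank_range_add_finrank_ker
    rw [LinearMap.range_eq_top.2 hA, finrank_top] at h
    omega
  let e := ((stdOrthonormalBasis ℝ A.ker).reindex (finCongr hker)).repr
  refine ⟨A.ker.subtypeₗᵢ.comp e.symm.toLinearIsometry, ?_⟩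
  ext x
  constructor
  · rintro ⟨y, rfl⟩
    exact (e.symm y).2
  · intro hx
    exact ⟨e ⟨x, hx⟩, by simp⟩

lemma nonempty_linearIsometryEquiv_prod (h : finrank ℝ F + finrank ℝ G = finrank ℝ E) :
    Nonempty (WithLp 2 (F × G) ≃ₗᵢ[ℝ] E) := by
  have hfin : finrank ℝ (WithLp 2 (F × G)) = finrank ℝ E := by
    rw [(WithLp.linearEquiv 2 ℝ (F × G)).finrank_eq, finrank_prod, h]
  exact ⟨(stdOrthonormalBasis ℝ _).equiv (stdOrthonormalBasis ℝ _) (finCongr hfin)⟩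

/-- Completes `A` to an endomorphism by the orthogonal projection onto the range of `i`, which will
be the kernel of `A`. The isometry `J` identifies the target `F × G` with `E`, so that the
completed map has a determinant. -/
noncomputable def kernelCompletion (J : WithLp 2 (F × G) ≃ₗᵢ[ℝ] E) (A : E →L[ℝ] F)
    (i : G →ₗᵢ[ℝ] E) : E →L[ℝ] E :=
  J.toContinuousLinearEquiv.toContinuousLinearMap ∘L
    (WithLp.prodContinuousLinearEquiv 2 ℝ F G).symm.toContinuousLinearMap ∘L
      A.prod (i.toContinuousLinearMap†)

variable {A : E →L[ℝ] F} {i : G →ₗᵢ[ℝ] E} (J : WithLp 2 (F × G) ≃ₗᵢ[ℝ] E)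

omit [FiniteDimensional ℝ F] in
lemma kernelCompletion_apply (x : E) :
    kernelCompletion J A i x = J (WithLp.toLp 2 (A x, (i.toContinuousLinearMap†) x)) :=
  rfl

omit [FiniteDimensional ℝ F] in
lemma approximatesLinearOn_kernelCompletion (J : WithLp 2 (F × G) ≃ₗᵢ[ℝ] E) {f : E → F}
    {S : Set E} {δ : ℝ≥0} (hf : ApproximatesLinearOn f A S δ) :
    ApproximatesLinearOn (fun x => J (WithLp.toLp 2 (f x, (i.toContinuousLinearMap†) x)))
      (kernelCompletion J A i) S δ := by
  intro x hx y hy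
  rw [kernelCompletion_apply, ← map_sub, ← map_sub, LinearIsometryEquiv.norm_map,
    ← WithLp.toLp_sub, ← WithLp.toLp_sub, Prod.mk_sub_mk, Prod.mk_sub_mk, ← map_sub, sub_self,
    WithLp.norm_toLp_fst]
  exact hf x hx y hy

lemma adjoint_kernelCompletion_apply (y : E) :
    ((kernelCompletion J A i)†) y = (A†) (J.symm y).fst + i (J.symm y).snd := by
  refine ext_inner_left ℝ fun x => ?_
  rw [ContinuousLinearMap.adjoint_inner_right, kernelCompletion_apply, inner_add_right,
    ContinuousLinearMap.adjoint_inner_right, ← J.symm.inner_map_map, J.symm_apply_apply,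
    WithLp.prod_inner_apply]
  congr 1
  exact ContinuousLinearMap.adjoint_inner_left _ _ _

lemma adjoint_linearIsometry_apply_self (y : G) : (i.toContinuousLinearMap†) (i y) = y :=
  congr($(i.adjoint_comp_self) y)

lemma norm_adjoint_linearIsometry_apply_le (x : E) : ‖(i.toContinuousLinearMap†) x‖ ≤ ‖x‖ := by
  refine (ContinuousLinearMap.le_opNorm _ _).trans ?_
  rw [LinearIsometryEquiv.norm_map]
  exact mul_le_of_le_one_left (norm_nonneg _) i.norm_toContinuousLinearMap_le

omit [FiniteDimensional ℝ E] [FiniteDimensional ℝ F] [FiniteDimensional ℝ G] in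
lemma apply_eq_zero_of_range_eq_ker (hi : i.toLinearMap.range = A.ker) (y : G) : A (i y) = 0 :=
  LinearMap.mem_ker.1 (hi ▸ LinearMap.mem_range_self i.toLinearMap y)

lemma adjoint_linearIsometry_comp_adjoint (hi : i.toLinearMap.range = A.ker) :
    (i.toContinuousLinearMap†) ∘L A† = 0 := by
  have h : A ∘L i.toContinuousLinearMap = 0 :=
    ContinuousLinearMap.ext (apply_eq_zero_of_range_eq_ker hi)
  rw [← ContinuousLinearMap.adjoint_comp, h, map_zero]

lemma kernelCompletion_comp_adjoint (hi : i.toLinearMap.range = A.ker) :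
    (kernelCompletion J A i ∘L (kernelCompletion J A i)†).toLinearMap =
      ((WithLp.linearEquiv 2 ℝ (F × G)).symm.trans J.toLinearEquiv).conj
        ((A ∘L A†).toLinearMap.prodMap LinearMap.id) := by
  ext1 y
  change kernelCompletion J A i (((kernelCompletion J A i)†) y) =
    J (WithLp.toLp 2 (A ((A†) (J.symm y).fst), (J.symm y).snd))
  have hzero : (i.toContinuousLinearMap†) ((A†) (J.symm y).fst) = 0 :=
    congr($(adjoint_linearIsometry_comp_adjoint hi) _)
  rw [adjoint_kernelCompletion_apply, kernelCompletion_apply, map_add, map_add, hzero,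
    apply_eq_zero_of_range_eq_ker hi, adjoint_linearIsometry_apply_self, add_zero, zero_add]

lemma abs_det_kernelCompletion (hi : i.toLinearMap.range = A.ker) :
    |(kernelCompletion J A i).det| = coareaJacobian A := by
  have hcomm : ((kernelCompletion J A i)† ∘L kernelCompletion J A i).det =
      (kernelCompletion J A i ∘L (kernelCompletion J A i)†).det := by
    simp only [ContinuousLinearMap.det, ContinuousLinearMap.toLinearMap_comp, LinearMap.det_comp,
      mul_comm]
  have hdet : (kernelCompletion J A i ∘L (kernelCompletion J A i)†).det = (A ∘L A†).det := by
    rw [ContinuousLinearMap.det, kernelCompletion_comp_adjoint J hi, LinearEquiv.conj_apply,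
      LinearMap.comp_assoc, LinearMap.det_conj, LinearMap.det_prodMap, LinearMap.det_id, mul_one,
      ContinuousLinearMap.det]
  have hsq := (kernelCompletion J A i).normDet_sq
  rw [hcomm, hdet, LinearMap.normDet_eq_abs_det] at hsq
  rw [coareaJacobian, ← hsq]
  exact (Real.sqrt_sq (abs_nonneg _)).symm

lemma exists_norm_le_adjoint_add (hA : Function.Surjective A) (hi : i.toLinearMap.range = A.ker) :
    ∃ C : ℝ≥0, ∀ x, ‖x‖ ≤ ‖(i.toContinuousLinearMap†) x‖ + C * ‖A x‖ := by
  obtain ⟨R, hR⟩ := A.exists_rightInverse_of_surjective (LinearMap.range_eq_top.2 hA)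
  refine ⟨2 * ‖R‖₊, fun x => ?_⟩
  set P := i.toContinuousLinearMap†
  have hAR : A (R (A x)) = A x := congr($hR (A x))
  obtain ⟨y, hy⟩ : x - R (A x) ∈ i.toLinearMap.range := by
    rw [hi, LinearMap.mem_ker]
    simp [hAR]
  have hker : ‖x - R (A x)‖ = ‖P (x - R (A x))‖ := by
    rw [← hy]
    exact (i.norm_map y).trans congr(‖$(adjoint_linearIsometry_apply_self y)‖).symm
  calc ‖x‖ ≤ ‖x - R (A x)‖ + ‖R (A x)‖ := by simpa using norm_add_le (x - R (A x)) (R (A x))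
    _ ≤ ‖P x‖ + ‖P (R (A x))‖ + ‖R (A x)‖ := by
      rw [hker, map_sub]
      gcongr
      exact norm_sub_le _ _
    _ ≤ ‖P x‖ + ‖R (A x)‖ + ‖R (A x)‖ := by
      gcongr
      exact norm_adjoint_linearIsometry_apply_le _
    _ = ‖P x‖ + 2 * ‖R (A x)‖ := by ring
    _ ≤ ‖P x‖ + 2 * (‖R‖ * ‖A x‖) := by
      gcongr
      exact R.le_opNorm _
    _ = ‖P x‖ + (2 * ‖R‖₊ : ℝ≥0) * ‖A x‖ := by
      push_cast
      ring

end Linear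

section FiberMeasurement

section Hausdorff

variable {E F : Type*} [MeasurableSpace E] [EMetricSpace E] [BorelSpace E]
  [MeasurableSpace F] [EMetricSpace F] [BorelSpace F] {f : E → F} {s : Set E} {K : ℝ≥0}

lemma euclideanHausdorffMeasure_image_le_of_lipschitzOnWith (h : LipschitzOnWith K f s) (d : ℕ) :
    μHE[d] (f '' s) ≤ (K : ℝ≥0∞) ^ d * μHE[d] s := by
  have hle := h.hausdorffMeasure_image_le d.cast_nonneg
  rw [ENNReal.rpow_natCast] at hle
  simp only [Measure.euclideanHausdorffMeasure_def, Measure.smul_apply, ENNReal.smul_def,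
    smul_eq_mul]
  rw [mul_left_comm]
  gcongr

lemma euclideanHausdorffMeasure_le_of_edist_le
    (h : ∀ x ∈ s, ∀ y ∈ s, edist x y ≤ K * edist (f x) (f y)) (d : ℕ) :
    μHE[d] s ≤ (K : ℝ≥0∞) ^ d * μHE[d] (f '' s) := by
  rcases s.eq_empty_or_nonempty with rfl | ⟨x₀, -⟩
  · simp
  have : Nonempty E := ⟨x₀⟩
  have hinj : Set.InjOn f s := fun x hx y hy hxy => by
    simpa [hxy] using h x hx y hy
  have hinv : LipschitzOnWith K (Function.invFunOn f s) (f '' s) := by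
    rintro _ ⟨x, hx, rfl⟩ _ ⟨y, hy, rfl⟩
    rw [hinj.leftInvOn_invFunOn hx, hinj.leftInvOn_invFunOn hy]
    exact h x hx y hy
  have hle := euclideanHausdorffMeasure_image_le_of_lipschitzOnWith hinv d
  rwa [hinj.leftInvOn_invFunOn.image_image] at hle

lemma eqUpToFactor_euclideanHausdorffMeasure_image (hlip : LipschitzOnWith K f s)
    (hanti : ∀ x ∈ s, ∀ y ∈ s, edist x y ≤ K * edist (f x) (f y)) (d : ℕ) :
    EqUpToFactor (K ^ d) (μHE[d] (f '' s)) (μHE[d] s) := by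
  rw [EqUpToFactor, ENNReal.coe_pow]
  exact ⟨euclideanHausdorffMeasure_image_le_of_lipschitzOnWith hlip d,
    euclideanHausdorffMeasure_le_of_edist_le hanti d⟩

end Hausdorff

lemma exists_one_lt_pow_le {c : ℝ≥0} (hc : 1 < c) (d : ℕ) : ∃ K : ℝ≥0, 1 < K ∧ K ^ d ≤ c := by
  have hlim : Tendsto (fun K : ℝ≥0 => K ^ d) (𝓝[>] 1) (𝓝 1) :=
    ((continuous_pow d).tendsto' 1 1 (one_pow _)).mono_left nhdsWithin_le_nhds
  obtain ⟨K, hKc, hK⟩ := ((hlim.eventually (ge_mem_nhds hc)).and self_mem_nhdsWithin).exists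
  exact ⟨K, hK, hKc⟩

lemma eventually_eqUpToFactor_measure_image {E : Type*} [NormedAddCommGroup E] [NormedSpace ℝ E]
    [FiniteDimensional ℝ E] [MeasurableSpace E] [BorelSpace E] (μ : Measure E)
    [μ.IsAddHaarMeasure] {T : E →L[ℝ] E} (hT : T.det ≠ 0) {c : ℝ≥0} (hc : 1 < c) :
    ∀ᶠ δ in 𝓝[>] (0 : ℝ≥0), ∀ (f : E → E) (S : Set E), ApproximatesLinearOn f T S δ →
      EqUpToFactor c (μ (f '' S)) (ENNReal.ofReal |T.det| * μ S) := by
  have hc0 : 0 < c := zero_lt_one.trans hc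
  set t : ℝ≥0 := Real.toNNReal |T.det|
  have ht : 0 < t := Real.toNNReal_pos.2 (abs_pos.2 hT)
  filter_upwards [addHaar_image_le_mul_of_det_lt μ T (m := c * t)
      (ENNReal.coe_lt_coe.2 (lt_mul_of_one_lt_left ht hc)),
    mul_le_addHaar_image_of_lt_det μ T (m := c⁻¹ * t)
      (ENNReal.coe_lt_coe.2 (mul_lt_of_lt_one_left ht (inv_lt_one_of_one_lt₀ hc)))]
    with δ hupper hlower f S hf
  constructor
  · change _ ≤ (c : ℝ≥0∞) * (t * μ S)
    rw [← mul_assoc, ← ENNReal.coe_mul]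
    exact hupper S f hf
  · calc (t : ℝ≥0∞) * μ S = c * ((c⁻¹ * t : ℝ≥0) * μ S) := by
          rw [← mul_assoc, ← ENNReal.coe_mul, mul_inv_cancel_left₀ hc0.ne']
      _ ≤ c * μ (f '' S) := by
          gcongr
          exact hlower S f hf

lemma eventually_norm_sub_le_of_approximatesLinearOn {E F G : Type*}
    [NormedAddCommGroup E] [NormedSpace ℝ E] [NormedAddCommGroup F] [NormedSpace ℝ F]
    [NormedAddCommGroup G] [NormedSpace ℝ G] {A : E →L[ℝ] F} {P : E →L[ℝ] G} {C : ℝ≥0}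
    (hC : ∀ x, ‖x‖ ≤ ‖P x‖ + C * ‖A x‖) {K : ℝ≥0} (hK : 1 < K) :
    ∀ᶠ δ in 𝓝[>] (0 : ℝ≥0), ∀ (f : E → F) (S : Set E), ApproximatesLinearOn f A S δ →
      ∀ x ∈ S, ∀ y ∈ S, f x = f y → ‖x - y‖ ≤ K * ‖P x - P y‖ := by
  have hK' : K⁻¹ < 1 := inv_lt_one_of_one_lt₀ hK
  have hlim : Tendsto (fun δ : ℝ≥0 => C * δ) (𝓝[>] 0) (𝓝 0) :=
    ((continuous_const_mul C).tendsto' 0 0 (mul_zero _)).mono_left nhdsWithin_le_nhds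
  filter_upwards [hlim.eventually (ge_mem_nhds (tsub_pos_of_lt hK'))] with δ hδ f S hf x hx y hy hxy
  have hδ' : (C * δ : ℝ) ≤ 1 - (K : ℝ)⁻¹ := by
    rw [← NNReal.coe_inv, ← NNReal.coe_one, ← NNReal.coe_sub hK'.le]
    exact_mod_cast hδ
  have hA : ‖A (x - y)‖ ≤ δ * ‖x - y‖ := by
    have h := hf x hx y hy
    rwa [hxy, sub_self, zero_sub, norm_neg] at h
  have hsmall : C * ‖A (x - y)‖ ≤ (1 - (K : ℝ)⁻¹) * ‖x - y‖ :=
    calc (C : ℝ) * ‖A (x - y)‖ ≤ C * (δ * ‖x - y‖) := by gcongr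
      _ = C * δ * ‖x - y‖ := (mul_assoc _ _ _).symm
      _ ≤ (1 - (K : ℝ)⁻¹) * ‖x - y‖ := by gcongr
  rw [← inv_mul_le_iff₀ (by exact_mod_cast zero_lt_one.trans hK), ← map_sub]
  linarith [hC (x - y)]

lemma image_inter_preimage_singleton {α β γ : Type*} (f : α → β) (g : α → γ) (s : Set α) (z : β) :
    g '' (s ∩ f ⁻¹' {z}) = Prod.mk z ⁻¹' ((fun x => (f x, g x)) '' s) := by
  ext y
  simp only [Set.mem_image, Set.mem_inter_iff, Set.mem_preimage, Set.mem_singleton_iff,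
    Prod.mk.injEq, and_assoc]

lemma eqUpToFactor_volume_image_fiber {E F G : Type*}
    [NormedAddCommGroup E] [InnerProductSpace ℝ E] [FiniteDimensional ℝ E]
    [MeasurableSpace E] [BorelSpace E]
    [NormedAddCommGroup G] [InnerProductSpace ℝ G] [FiniteDimensional ℝ G]
    [MeasurableSpace G] [BorelSpace G] {i : G →ₗᵢ[ℝ] E}
    {f : E → F} {S : Set E} {K : ℝ≥0} (hK : 1 ≤ K)
    (hanti : ∀ x ∈ S, ∀ y ∈ S, f x = f y →
      ‖x - y‖ ≤ K * ‖(i.toContinuousLinearMap†) x - (i.toContinuousLinearMap†) y‖) (z : F) :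
    EqUpToFactor (K ^ finrank ℝ G) (volume ((i.toContinuousLinearMap†) '' (S ∩ f ⁻¹' {z})))
      (μHE[finrank ℝ G] (S ∩ f ⁻¹' {z})) := by
  rw [← InnerProductSpace.euclideanHausdorffMeasure_eq_volume]
  refine eqUpToFactor_euclideanHausdorffMeasure_image ?_ (fun x hx y hy => ?_) _
  · refine ((LipschitzWith.of_dist_le_mul fun x y => ?_).weaken hK).lipschitzOnWith
    rw [dist_eq_norm, dist_eq_norm, ← map_sub, NNReal.coe_one, one_mul]
    exact norm_adjoint_linearIsometry_apply_le _
  · rw [edist_eq_enorm_sub, edist_eq_enorm_sub]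
    simp only [enorm_eq_nnnorm]
    exact_mod_cast hanti x hx.1 y hy.1 (hx.2.trans hy.2.symm)

end FiberMeasurement

section LinearPiece

variable {E F : Type*}
  [NormedAddCommGroup E] [InnerProductSpace ℝ E] [FiniteDimensional ℝ E]
  [MeasurableSpace E] [BorelSpace E]
  [NormedAddCommGroup F] [InnerProductSpace ℝ F] [FiniteDimensional ℝ F]
  [MeasurableSpace F] [BorelSpace F]

/-- The coarea formula `∫ H(S ∩ f⁻¹(z)) dz = v` up to the factor `c`. The measure of the fibers is
replaced by a measurable function `g` because it is not yet known to be measurable itself. -/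
def CoareaUpToFactor (c : ℝ≥0) (f : E → F) (S : Set E) (v : ℝ≥0∞) : Prop :=
  ∃ g : F → ℝ≥0∞, Measurable g ∧
    (∀ z, EqUpToFactor c (g z) (μHE[finrank ℝ E - finrank ℝ F] (S ∩ f ⁻¹' {z}))) ∧
    EqUpToFactor c (∫⁻ z, g z) v

variable {G : Type*} [NormedAddCommGroup G] [InnerProductSpace ℝ G] [FiniteDimensional ℝ G]
  [MeasurableSpace G] [BorelSpace G]

lemma volume_image_linearIsometryEquiv_toLp (J : WithLp 2 (F × G) ≃ₗᵢ[ℝ] E) (s : Set (F × G)) :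
    volume ((fun q => J (WithLp.toLp 2 q)) '' s) = volume s := by
  have hpres : MeasurePreserving (fun q : F × G => J (WithLp.toLp 2 q)) :=
    J.measurePreserving.comp (WithLp.volume_preserving_toLp F G)
  have hemb : MeasurableEmbedding (fun q : F × G => J (WithLp.toLp 2 q)) :=
    ((MeasurableEquiv.toLp 2 (F × G)).trans J.toMeasurableEquiv).measurableEmbedding
  rw [← hpres.measure_preimage_emb hemb, hemb.injective.preimage_image]

lemma eventually_coareaUpToFactor {A : E →L[ℝ] F} (hA : Function.Surjective A)
    {c : ℝ≥0} (hc : 1 < c) :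
    ∀ᶠ δ in 𝓝[>] (0 : ℝ≥0), ∀ (f : E → F) (S : Set E), MeasurableSet S →
      ApproximatesLinearOn f A S δ →
      CoareaUpToFactor c f S (ENNReal.ofReal (coareaJacobian A) * volume S) := by
  obtain ⟨i, hi⟩ := exists_linearIsometry_range_eq_ker hA
  have hdim : finrank ℝ F ≤ finrank ℝ E := LinearMap.finrank_le_finrank_of_surjective hA
  obtain ⟨J⟩ := nonempty_linearIsometryEquiv_prod (E := E) (F := F)
    (G := EuclideanSpace ℝ (Fin (finrank ℝ E - finrank ℝ F)))
    (by rw [finrank_euclideanSpace_fin, Nat.add_sub_cancel' hdim])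
  obtain ⟨C, hC⟩ := exists_norm_le_adjoint_add hA hi
  obtain ⟨K, hK, hKc⟩ := exists_one_lt_pow_le hc (finrank ℝ E - finrank ℝ F)
  have hdet : (kernelCompletion J A i).det ≠ 0 := by
    rw [← abs_pos, abs_det_kernelCompletion J hi]
    exact coareaJacobian_pos_iff.2 hA
  filter_upwards [eventually_eqUpToFactor_measure_image volume hdet hc,
    eventually_norm_sub_le_of_approximatesLinearOn hC hK] with δ hvol hnorm f S hS hf
  set P := i.toContinuousLinearMap†
  have hanti := hnorm f S hf
  have hinj : Set.InjOn (fun x => (f x, P x)) S := by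
    intro x hx y hy hxy
    obtain ⟨hfxy, hPxy⟩ := Prod.mk.inj hxy
    simpa [hPxy, sub_eq_zero] using hanti x hx y hy hfxy
  have himage : MeasurableSet ((fun x => (f x, P x)) '' S) :=
    hS.image_of_continuousOn_injOn (hf.continuousOn.prodMk P.continuous.continuousOn) hinj
  refine ⟨fun z => volume (P '' (S ∩ f ⁻¹' {z})), ?_, fun z => ?_, ?_⟩
  · simp only [image_inter_preimage_singleton]
    exact measurable_measure_prodMk_left himage
  · have hfiber := eqUpToFactor_volume_image_fiber hK.le hanti z
    rw [finrank_euclideanSpace_fin] at hfiber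
    exact hfiber.mono hKc
  · have h := hvol _ S (approximatesLinearOn_kernelCompletion J hf)
    rwa [abs_det_kernelCompletion J hi, ← Set.image_image (fun q => J (WithLp.toLp 2 q)),
      volume_image_linearIsometryEquiv_toLp, Measure.volume_eq_prod, Measure.prod_apply himage,
      ← funext fun z => congrArg volume (image_inter_preimage_singleton f P S z)] at h

end LinearPiece

section Bind

variable {α β : Type*} [MeasurableSpace α] [MeasurableSpace β] {m : Measure β}
  {ν : β → Measure α}

lemma ae_nullMeasurableSet_of_bind (hν : AEMeasurable ν m) {s : Set α}
    (hs : NullMeasurableSet s (m.bind ν)) : ∀ᵐ z ∂m, NullMeasurableSet s (ν z) := by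
  obtain ⟨t, ht, hst⟩ := hs
  exact (Measure.ae_ae_of_ae_bind hν hst).mono fun z hz => ⟨t, ht, hz⟩

lemma map_withDensity_bind (hν : AEMeasurable ν m) {f : α → β} (hf : AEMeasurable f (m.bind ν))
    (hfiber : ∀ᵐ z ∂m, ∀ᵐ x ∂ν z, f x = z) {h : α → ℝ≥0∞} (hh : AEMeasurable h (m.bind ν)) :
    ((m.bind ν).withDensity h).map f = m.withDensity fun z => ∫⁻ x, h x ∂ν z := by
  ext B hB
  have hpre : NullMeasurableSet (f ⁻¹' B) (m.bind ν) := hf.nullMeasurable hB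
  rw [Measure.map_apply_of_aemeasurable (hf.mono_ac (withDensity_absolutelyContinuous _ _)) hB,
    withDensity_apply₀ _ hpre, withDensity_apply _ hB, ← lintegral_indicator₀ hpre,
    Measure.lintegral_bind hν (hh.indicator₀ hpre), ← lintegral_indicator hB]
  refine lintegral_congr_ae (hfiber.mono fun z hz => ?_)
  have hcongr : (f ⁻¹' B).indicator h =ᵐ[ν z] fun x => B.indicator (fun _ => h x) z :=
    hz.mono fun x hx => by rw [← hx]; rfl
  change _ = _
  simp only [lintegral_congr_ae hcongr]
  by_cases hzB : z ∈ B <;> simp [hzB]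

end Bind

section RegularSet

variable {E F : Type*} [NormedAddCommGroup E] [NormedAddCommGroup F]

section Normed

variable [NormedSpace ℝ E] [NormedSpace ℝ F] {f : E → F}

/-- The set of regular points of `f`, where the derivative has full rank. The derivative exists
there: otherwise `fderiv ℝ f x` would be `0`, which is surjective only if all functions with values
in `F` are constant. -/
def regularSet (f : E → F) : Set E :=
  {x | Function.Surjective (fderiv ℝ f x)}

lemma differentiableAt_of_mem_regularSet {x : E} (hx : x ∈ regularSet f) :
    DifferentiableAt ℝ f x := by
  by_contra hdiff
  have hzero : Function.Surjective (0 : E →L[ℝ] F) := by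
    rw [← fderiv_zero_of_not_differentiableAt hdiff]
    exact hx
  have : Subsingleton F := subsingleton_of_forall_eq 0 fun y => (hzero y).choose_spec.symm
  exact hdiff (Subsingleton.elim (fun _ => 0) f ▸ differentiableAt_const 0)

lemma continuousOn_regularSet (f : E → F) : ContinuousOn f (regularSet f) := fun _ hx =>
  (differentiableAt_of_mem_regularSet hx).continuousAt.continuousWithinAt

lemma measurableSet_inter_preimage_of_subset_regularSet [MeasurableSpace E] [BorelSpace E]
    [MeasurableSpace F] [BorelSpace F] {S : Set E} (hS : MeasurableSet S) (hSf : S ⊆ regularSet f)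
    {B : Set F} (hB : MeasurableSet B) : MeasurableSet (S ∩ f ⁻¹' B) := by
  have h := hS.subtype_image ((continuousOn_iff_continuous_domRestrict.1
    ((continuousOn_regularSet f).mono hSf)).measurable hB)
  rwa [Set.domRestrict_eq, Set.preimage_comp, Subtype.image_preimage_coe] at h

end Normed

variable [InnerProductSpace ℝ E] [FiniteDimensional ℝ E] [InnerProductSpace ℝ F]
  [FiniteDimensional ℝ F]

lemma mem_regularSet_iff_coareaJacobian_pos {f : E → F} {x : E} :
    x ∈ regularSet f ↔ 0 < coareaJacobian (fderiv ℝ f x) :=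
  coareaJacobian_pos_iff.symm

lemma coareaJacobian_eq_zero_of_notMem_regularSet {f : E → F} {x : E}
    (hx : x ∉ regularSet f) :
    coareaJacobian (fderiv ℝ f x) = 0 :=
  le_antisymm (not_lt.1 (mem_regularSet_iff_coareaJacobian_pos.not.1 hx)) (Real.sqrt_nonneg _)

variable [MeasurableSpace E] [BorelSpace E]

lemma measurable_coareaJacobian_fderiv (f : E → F) :
    Measurable fun x => coareaJacobian (fderiv ℝ f x) :=
  continuous_coareaJacobian.measurable.comp (measurable_fderiv ℝ f)

lemma measurableSet_regularSet (f : E → F) : MeasurableSet (regularSet f) := by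
  simp only [Set.ext fun x => mem_regularSet_iff_coareaJacobian_pos (f := f) (x := x)]
  exact measurableSet_lt measurable_const (measurable_coareaJacobian_fderiv f)

end RegularSet

section Coarea

variable {E F : Type*}
  [NormedAddCommGroup E] [InnerProductSpace ℝ E] [FiniteDimensional ℝ E]
  [MeasurableSpace E] [BorelSpace E]
  [NormedAddCommGroup F] [InnerProductSpace ℝ F] [FiniteDimensional ℝ F]
  [MeasurableSpace F] [BorelSpace F] {f : E → F} {S : Set E}

omit [FiniteDimensional ℝ E] in
lemma CoareaUpToFactor.iUnion {ι : Type*} [Countable ι] {S : ι → Set E} {v : ι → ℝ≥0∞} {c : ℝ≥0}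
    (hS : ∀ k z, MeasurableSet (S k ∩ f ⁻¹' {z})) (hdisj : Pairwise (Function.onFun Disjoint S))
    (h : ∀ k, CoareaUpToFactor c f (S k) (v k)) :
    CoareaUpToFactor c f (⋃ k, S k) (∑' k, v k) := by
  choose g hg hfiber hint using h
  refine ⟨fun z => ∑' k, g k z, Measurable.tsum hg, fun z => ?_, ?_⟩
  · rw [Set.iUnion_inter, measure_iUnion (fun i j hij => (hdisj hij).mono Set.inter_subset_left
      Set.inter_subset_left) fun k => hS k z]
    exact EqUpToFactor.tsum fun k => hfiber k z
  · rw [lintegral_tsum fun k => (hg k).aemeasurable]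
    exact EqUpToFactor.tsum hint

lemma coareaUpToFactor_of_coareaJacobian_eqUpToFactor (hS : MeasurableSet S)
    (hSf : S ⊆ regularSet f) {c : ℝ≥0} (hc : 1 < c)
    (hJ : ∀ x ∈ S, ∀ y ∈ S, EqUpToFactor c (ENNReal.ofReal (coareaJacobian (fderiv ℝ f x)))
      (ENNReal.ofReal (coareaJacobian (fderiv ℝ f y)))) :
    CoareaUpToFactor (c * c) f S (∫⁻ x in S, ENNReal.ofReal (coareaJacobian (fderiv ℝ f x))) := by
  have hδ (A : E →L[ℝ] F) : ∃ δ : ℝ≥0, δ ≠ 0 ∧ (Function.Surjective A →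
      ∀ T, MeasurableSet T → ApproximatesLinearOn f A T δ →
        CoareaUpToFactor c f T (ENNReal.ofReal (coareaJacobian A) * volume T)) := by
    by_cases hA : Function.Surjective A
    · obtain ⟨δ, hcoarea, hδ⟩ :=
        ((eventually_coareaUpToFactor hA hc).and self_mem_nhdsWithin).exists
      exact ⟨δ, pos_iff_ne_zero.1 hδ, fun _ => hcoarea f⟩
    · exact ⟨1, one_ne_zero, fun h => absurd h hA⟩
  choose δ hδ hcoarea using hδ
  obtain ⟨t, A, hdisj, ht, hcover, happrox, hA⟩ :=
    exists_partition_approximatesLinearOn_of_hasFDerivWithinAt f S (fderiv ℝ f)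
      (fun x hx => (differentiableAt_of_mem_regularSet (hSf hx)).hasFDerivAt.hasFDerivWithinAt) δ hδ
  have hpiece (k : ℕ) : CoareaUpToFactor (c * c) f (S ∩ t k)
      (∫⁻ x in S ∩ t k, ENNReal.ofReal (coareaJacobian (fderiv ℝ f x))) := by
    have hSt := hS.inter (ht k)
    rcases S.eq_empty_or_nonempty with rfl | hne
    · exact ⟨0, measurable_zero, by simp [EqUpToFactor], by simp [EqUpToFactor]⟩
    obtain ⟨y, hy, hAy⟩ := hA hne k
    have happrox_k := happrox k
    rw [hAy] at happrox_k
    obtain ⟨g, hg, hfiber, hint⟩ := hcoarea _ (hSf hy) _ hSt happrox_k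
    refine ⟨g, hg, fun z => (hfiber z).mono (le_mul_of_one_le_right' hc.le), hint.trans ?_⟩
    rw [← setLIntegral_const]
    exact EqUpToFactor.lintegral ((ae_restrict_mem hSt).mono fun x hx => hJ y hy x hx.1)
  have hunion := CoareaUpToFactor.iUnion
    (fun k z => measurableSet_inter_preimage_of_subset_regularSet (hS.inter (ht k))
      (Set.inter_subset_left.trans hSf) (measurableSet_singleton z))
    (fun i j hij => (hdisj hij).mono Set.inter_subset_right Set.inter_subset_right) hpiece
  rwa [← lintegral_iUnion (fun k => hS.inter (ht k)) fun i j hij =>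
    (hdisj hij).mono Set.inter_subset_right Set.inter_subset_right, ← Set.inter_iUnion,
    Set.inter_eq_left.2 hcover] at hunion

lemma eqUpToFactor_of_mem_Ico_zpow {c : ℝ≥0} (hc : 1 < c) {k : ℤ} {a b : ℝ≥0∞}
    (ha : a ∈ Set.Ico ((c : ℝ≥0∞) ^ k) (c ^ (k + 1)))
    (hb : b ∈ Set.Ico ((c : ℝ≥0∞) ^ k) (c ^ (k + 1))) : EqUpToFactor c a b := by
  have hle {a b : ℝ≥0∞} (ha : a ∈ Set.Ico ((c : ℝ≥0∞) ^ k) (c ^ (k + 1)))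
      (hb : b ∈ Set.Ico ((c : ℝ≥0∞) ^ k) (c ^ (k + 1))) : a ≤ c * b := by
    calc a ≤ (c : ℝ≥0∞) ^ (k + 1) := ha.2.le
      _ = c * c ^ k := by
        rw [ENNReal.zpow_add (by exact_mod_cast (zero_lt_one.trans hc).ne') ENNReal.coe_ne_top,
          zpow_one, mul_comm]
      _ ≤ c * b := by gcongr; exact hb.1
  exact ⟨hle ha hb, hle hb ha⟩

lemma coareaUpToFactor_of_subset_regularSet (hS : MeasurableSet S) (hSf : S ⊆ regularSet f)
    {c : ℝ≥0} (hc : 1 < c) :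
    CoareaUpToFactor (c * c) f S (∫⁻ x in S, ENNReal.ofReal (coareaJacobian (fderiv ℝ f x))) := by
  set u : E → ℝ≥0∞ := fun x => ENNReal.ofReal (coareaJacobian (fderiv ℝ f x))
  set T : ℤ → Set E := fun k => u ⁻¹' Set.Ico ((c : ℝ≥0∞) ^ k) (c ^ (k + 1))
  have hT (k : ℤ) : MeasurableSet (S ∩ T k) :=
    hS.inter ((measurable_coareaJacobian_fderiv f).ennreal_ofReal measurableSet_Ico)
  have hTf (k : ℤ) : S ∩ T k ⊆ regularSet f := Set.inter_subset_left.trans hSf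
  have hdisj : Pairwise (Function.onFun Disjoint fun k => S ∩ T k) := fun j k hjk =>
    (((ENNReal.monotone_zpow (ENNReal.one_le_coe_iff.2 hc.le)).pairwise_disjoint_on_Ico_succ
      hjk).preimage u).mono Set.inter_subset_right Set.inter_subset_right
  have hcover : S ⊆ ⋃ k, T k := fun x hx => Set.mem_iUnion.2 <|
    ENNReal.exists_mem_Ico_zpow
      (ENNReal.ofReal_pos.2 (mem_regularSet_iff_coareaJacobian_pos.1 (hSf hx))).ne'
      ENNReal.ofReal_ne_top (ENNReal.one_lt_coe_iff.2 hc) ENNReal.coe_ne_top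
  have hunion := CoareaUpToFactor.iUnion
    (fun k z => measurableSet_inter_preimage_of_subset_regularSet (hT k) (hTf k)
      (measurableSet_singleton z)) hdisj
    fun k => coareaUpToFactor_of_coareaJacobian_eqUpToFactor (hT k) (hTf k) hc
      fun x hx y hy => eqUpToFactor_of_mem_Ico_zpow hc hx.2 hy.2
  rwa [← lintegral_iUnion hT hdisj, ← Set.inter_iUnion, Set.inter_eq_left.2 hcover] at hunion

lemma measurable_euclideanHausdorffMeasure_fiber_and_lintegral_eq (hS : MeasurableSet S)
    (hSf : S ⊆ regularSet f) :
    Measurable (fun z => μHE[finrank ℝ E - finrank ℝ F] (S ∩ f ⁻¹' {z})) ∧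
      ∫⁻ z, μHE[finrank ℝ E - finrank ℝ F] (S ∩ f ⁻¹' {z}) =
        ∫⁻ x in S, ENNReal.ofReal (coareaJacobian (fderiv ℝ f x)) := by
  obtain ⟨u, -, hu, hlim⟩ := exists_seq_strictAnti_tendsto (1 : ℝ≥0)
  have hlim2 : Tendsto (fun m => u m * u m) atTop (𝓝 1) := by simpa using hlim.mul hlim
  have hlim4 : Tendsto (fun m => u m * u m * (u m * u m)) atTop (𝓝 1) := by
    simpa using hlim2.mul hlim2
  choose g hg hfiber hint using fun m => coareaUpToFactor_of_subset_regularSet hS hSf (hu m)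
  refine ⟨ENNReal.measurable_of_tendsto hg
    (tendsto_pi_nhds.2 fun z => tendsto_of_eqUpToFactor hlim2 fun m => hfiber m z), ?_⟩
  exact eq_of_forall_eqUpToFactor hlim4 fun m =>
    (EqUpToFactor.lintegral (ae_of_all _ fun z => (hfiber m z).symm)).trans (hint m)

/-- The Hausdorff measure on the regular part of the fiber `f⁻¹(z)`, the fiber measure of the
coarea formula. -/
noncomputable def regularFiberMeasure (f : E → F) (z : F) : Measure E :=
  μHE[finrank ℝ E - finrank ℝ F].restrict (regularSet f ∩ f ⁻¹' {z})

lemma measurable_regularFiberMeasure (f : E → F) : Measurable (regularFiberMeasure f) := by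
  refine Measure.measurable_of_measurable_coe _ fun S hS => ?_
  simp only [regularFiberMeasure, Measure.restrict_apply hS, ← Set.inter_assoc]
  exact (measurable_euclideanHausdorffMeasure_fiber_and_lintegral_eq
    (hS.inter (measurableSet_regularSet f)) Set.inter_subset_right).1

lemma bind_regularFiberMeasure (f : E → F) :
    volume.bind (regularFiberMeasure f) =
      volume.withDensity fun x => ENNReal.ofReal (coareaJacobian (fderiv ℝ f x)) := by
  ext S hS
  rw [Measure.bind_apply hS (measurable_regularFiberMeasure f).aemeasurable,
    withDensity_apply _ hS]
  simp only [regularFiberMeasure, Measure.restrict_apply hS, ← Set.inter_assoc]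
  rw [(measurable_euclideanHausdorffMeasure_fiber_and_lintegral_eq
    (hS.inter (measurableSet_regularSet f)) Set.inter_subset_right).2, Set.inter_comm,
    ← Measure.restrict_restrict (measurableSet_regularSet f)]
  refine setLIntegral_eq_of_support_subset fun x hx => ?_
  by_contra hreg
  refine hx ?_
  simp only [coareaJacobian_eq_zero_of_notMem_regularSet hreg, ENNReal.ofReal_zero]

lemma ae_regularFiberMeasure_eq (f : E → F) (z : F) : ∀ᵐ x ∂regularFiberMeasure f z, f x = z :=
  (ae_restrict_mem (measurableSet_inter_preimage_of_subset_regularSet (measurableSet_regularSet f)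
    subset_rfl (measurableSet_singleton z))).mono fun _ hx => hx.2

lemma aemeasurable_bind_regularFiberMeasure (f : E → F) :
    AEMeasurable f (volume.bind (regularFiberMeasure f)) := by
  have hregular : ∀ᵐ x ∂volume.bind (regularFiberMeasure f), x ∈ regularSet f := by
    rw [bind_regularFiberMeasure,
      ae_withDensity_iff (measurable_coareaJacobian_fderiv f).ennreal_ofReal]
    refine ae_of_all _ fun x hx => mem_regularSet_iff_coareaJacobian_pos.2 ?_
    exact ENNReal.ofReal_pos.1 (pos_iff_ne_zero.2 hx)
  rw [← Measure.restrict_eq_self_of_ae_mem hregular]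
  exact (continuousOn_regularSet f).aemeasurable (measurableSet_regularSet f)

lemma map_withDensity_eq_withDensity_lintegral_regularFiberMeasure {ρ : E → ℝ≥0∞}
    (hρ : AEMeasurable ρ) (hreg : ∀ᵐ x ∂volume.withDensity ρ, x ∈ regularSet f) :
    (volume.withDensity ρ).map f = volume.withDensity fun z =>
      ∫⁻ x, ρ x * ENNReal.ofReal (coareaJacobian (fderiv ℝ f x))⁻¹ ∂regularFiberMeasure f z := by
  set u : E → ℝ≥0∞ := fun x => ENNReal.ofReal (coareaJacobian (fderiv ℝ f x)) with hu
  set w : E → ℝ≥0∞ := fun x => ENNReal.ofReal (coareaJacobian (fderiv ℝ f x))⁻¹ with hw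
  have hu_meas : Measurable u := (measurable_coareaJacobian_fderiv f).ennreal_ofReal
  have hw_meas : Measurable w := (measurable_coareaJacobian_fderiv f).inv.ennreal_ofReal
  have hρw : AEMeasurable (fun x => ρ x * w x) := hρ.mul hw_meas.aemeasurable
  have huw : (regularSet f).indicator ρ = u * fun x => ρ x * w x := by
    ext x
    by_cases hx : x ∈ regularSet f
    · have hpos := mem_regularSet_iff_coareaJacobian_pos.1 hx
      rw [Set.indicator_of_mem hx, Pi.mul_apply, mul_left_comm, hu, hw,
        ← ENNReal.ofReal_mul hpos.le, mul_inv_cancel₀ hpos.ne', ENNReal.ofReal_one, mul_one]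
    · rw [Set.indicator_of_notMem hx, Pi.mul_apply, hu]
      simp only [coareaJacobian_eq_zero_of_notMem_regularSet hx, ENNReal.ofReal_zero, zero_mul]
  have hbind : volume.withDensity ρ =
      (volume.bind (regularFiberMeasure f)).withDensity fun x => ρ x * w x := by
    rw [← Measure.restrict_eq_self_of_ae_mem hreg,
      restrict_withDensity (measurableSet_regularSet f),
      ← withDensity_indicator (measurableSet_regularSet f), huw,
      withDensity_mul₀ hu_meas.aemeasurable hρw, bind_regularFiberMeasure]
  rw [hbind, map_withDensity_bind (measurable_regularFiberMeasure f).aemeasurable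
    (aemeasurable_bind_regularFiberMeasure f) (ae_of_all _ (ae_regularFiberMeasure_eq f))]
  rw [bind_regularFiberMeasure]
  exact hρw.mono_ac (withDensity_absolutelyContinuous _ _)

end Coarea

section EffectiveMeasure

lemma restrict_withDensity_of_support_subset {α : Type*} [MeasurableSpace α] {m : Measure α}
    {s : Set α} {h : α → ℝ≥0∞} (hs : h.support ⊆ s) :
    (m.restrict s).withDensity h = m.withDensity h := by
  ext t ht
  rw [withDensity_apply _ ht, withDensity_apply _ ht, ← lintegral_indicator ht,
    ← lintegral_indicator ht]
  exact setLIntegral_eq_of_support_subset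
    ((Set.support_indicator.trans_subset Set.inter_subset_right).trans hs)

variable {n r : ℕ} {X : Set (EuclideanSpace ℝ (Fin n))} {Z : Set (EuclideanSpace ℝ (Fin r))}
  {π : EuclideanSpace ℝ (Fin n) → ℝ} {ξ : EuclideanSpace ℝ (Fin n) → EuclideanSpace ℝ (Fin r)}

lemma surfaceMeasure_eq_withDensity_regularFiberMeasure (X : Set (EuclideanSpace ℝ (Fin n)))
    (ξ : EuclideanSpace ℝ (Fin n) → EuclideanSpace ℝ (Fin r)) (z : EuclideanSpace ℝ (Fin r)) :
    surfaceMeasure X ξ z = ((regularFiberMeasure ξ z).restrict X).withDensity fun x =>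
      ENNReal.ofReal (coareaWeight ξ x) := by
  have hw : (regularSet ξ).indicator (fun x => ENNReal.ofReal (coareaWeight ξ x)) =
      fun x => ENNReal.ofReal (coareaWeight ξ x) := by
    refine Set.indicator_eq_self.2 fun x hx => ?_
    by_contra hreg
    refine hx ?_
    change ENNReal.ofReal (coareaJacobian (fderiv ℝ ξ x))⁻¹ = 0
    rw [coareaJacobian_eq_zero_of_notMem_regularSet hreg, inv_zero, ENNReal.ofReal_zero]
  have hfiber : MeasurableSet (regularSet ξ ∩ ξ ⁻¹' {z}) :=
    measurableSet_inter_preimage_of_subset_regularSet (measurableSet_regularSet ξ) subset_rfl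
      (measurableSet_singleton z)
  rw [surfaceMeasure, ← hw, withDensity_indicator (measurableSet_regularSet ξ),
    Measure.restrict_restrict (measurableSet_regularSet ξ), regularFiberMeasure,
    Measure.restrict_restrict' hfiber, finrank_euclideanSpace_fin, finrank_euclideanSpace_fin, hw]
  congr 2
  exact Set.inter_left_comm _ _ _

lemma effectiveDensity_ae_eq_lintegral_regularFiberMeasure (hX : NullMeasurableSet X)
    (π : EuclideanSpace ℝ (Fin n) → ℝ)
    (ξ : EuclideanSpace ℝ (Fin n) → EuclideanSpace ℝ (Fin r)) :
    effectiveDensity X π ξ =ᵐ[volume] fun z =>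
      ∫⁻ x, X.indicator (fun x => ENNReal.ofReal (π x)) x * ENNReal.ofReal (coareaWeight ξ x)
        ∂regularFiberMeasure ξ z := by
  have hbind : NullMeasurableSet X (volume.bind (regularFiberMeasure ξ)) := by
    rw [bind_regularFiberMeasure]
    exact hX.mono_ac (withDensity_absolutelyContinuous _ _)
  have hw : Measurable fun x => ENNReal.ofReal (coareaWeight ξ x) :=
    (measurable_coareaJacobian_fderiv ξ).inv.ennreal_ofReal
  filter_upwards [ae_nullMeasurableSet_of_bind (measurable_regularFiberMeasure ξ).aemeasurable
    hbind] with z hXz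
  rw [effectiveDensity, surfaceMeasure_eq_withDensity_regularFiberMeasure,
    lintegral_withDensity_eq_lintegral_mul_non_measurable _ hw
      (ae_of_all _ fun _ => ENNReal.ofReal_lt_top), ← lintegral_indicator₀ hXz]
  refine lintegral_congr fun x => ?_
  by_cases hx : x ∈ X <;> simp [hx, mul_comm]

lemma effectiveDensity_eq_zero_of_notMem (hmaps : Set.MapsTo ξ X Z)
    {z : EuclideanSpace ℝ (Fin r)} (hz : z ∉ Z) : effectiveDensity X π ξ z = 0 := by
  have hempty : levelSet X ξ z = ∅ :=
    Set.eq_empty_of_forall_notMem fun x hx => hz (hx.2 ▸ hmaps hx.1)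
  rw [effectiveDensity, surfaceMeasure, hempty, Measure.restrict_empty, withDensity_zero_left,
    lintegral_zero_measure]

lemma effectiveMeasure_eq_withDensity (hmaps : Set.MapsTo ξ X Z) :
    effectiveMeasure X Z π ξ = volume.withDensity (effectiveDensity X π ξ) :=
  restrict_withDensity_of_support_subset fun _ hz =>
    not_imp_comm.1 (effectiveDensity_eq_zero_of_notMem hmaps) hz

lemma stationaryMeasure_eq_withDensity_indicator (hX : NullMeasurableSet X)
    (π : EuclideanSpace ℝ (Fin n) → ℝ) :
    stationaryMeasure X π =
      volume.withDensity (X.indicator fun x => ENNReal.ofReal (π x)) := by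
  rw [← restrict_withDensity_of_support_subset (s := X) Set.support_indicator_subset]
  refine withDensity_congr_ae ((ae_restrict_mem₀ hX).mono fun x hx => ?_)
  rw [Set.indicator_of_mem hx]

lemma ae_stationaryMeasure_mem_regularSet
    (hregular : ∀ᵐ x ∂volume.restrict X, x ∈ regularSet ξ) :
    ∀ᵐ x ∂stationaryMeasure X π, x ∈ regularSet ξ :=
  withDensity_absolutelyContinuous _ _ hregular

lemma aemeasurable_stationaryMeasure_of_ae_mem_regularSet
    (hregular : ∀ᵐ x ∂volume.restrict X, x ∈ regularSet ξ) :
    AEMeasurable ξ (stationaryMeasure X π) := by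
  rw [← Measure.restrict_eq_self_of_ae_mem (ae_stationaryMeasure_mem_regularSet hregular)]
  exact (continuousOn_regularSet ξ).aemeasurable (measurableSet_regularSet ξ)

lemma map_stationaryMeasure (hX : NullMeasurableSet X) (hπ : AEMeasurable π (volume.restrict X))
    (hmaps : Set.MapsTo ξ X Z) (hregular : ∀ᵐ x ∂volume.restrict X, x ∈ regularSet ξ) :
    (stationaryMeasure X π).map ξ = effectiveMeasure X Z π ξ := by
  have hdensity := stationaryMeasure_eq_withDensity_indicator hX π
  rw [effectiveMeasure_eq_withDensity hmaps,
    withDensity_congr_ae (effectiveDensity_ae_eq_lintegral_regularFiberMeasure hX π ξ), hdensity]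
  refine map_withDensity_eq_withDensity_lintegral_regularFiberMeasure
    ((aemeasurable_indicator_iff₀ hX).2 hπ.ennreal_ofReal) ?_
  rw [← hdensity]
  exact ae_stationaryMeasure_mem_regularSet hregular

end EffectiveMeasure

section Pushforward

open ProbabilityTheory

variable {α β : Type*} [MeasurableSpace α] [StandardBorelSpace α] [Nonempty α]
  [MeasurableSpace β] {μ : Measure α} [IsFiniteMeasure μ] {φ : α → β}

lemma condDistrib_id_comp_map (hφ : AEMeasurable φ μ) :
    condDistrib id φ μ ∘ₘ μ.map φ = μ :=
  (condDistrib_comp_map hφ aemeasurable_id).trans Measure.map_id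

lemma ae_ae_condDistrib_id (hφ : AEMeasurable φ μ) {p : α → Prop} (hp : ∀ᵐ x ∂μ, p x) :
    ∀ᵐ y ∂μ.map φ, ∀ᵐ x ∂condDistrib id φ μ y, p x := by
  rw [← condDistrib_id_comp_map hφ] at hp
  exact Measure.ae_ae_of_ae_comp hp

variable [MeasurableEq β]

lemma ae_map_ae_condDistrib_id_eq (hφ : AEMeasurable φ μ) :
    ∀ᵐ y ∂μ.map φ, ∀ᵐ x ∂condDistrib id φ μ y, φ x = y := by
  have hmk : ∀ᵐ y ∂μ.map φ, ∀ᵐ x ∂condDistrib id φ μ y, hφ.mk φ x = y := by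
    refine Measure.ae_ae_of_ae_compProd (p := fun q => hφ.mk φ q.2 = q.1) ?_
    rw [compProd_map_condDistrib aemeasurable_id,
      ae_map_iff (p := fun q => hφ.mk φ q.2 = q.1) (hφ.prodMk aemeasurable_id)
        (measurableSet_eq_fun (hφ.measurable_mk.comp measurable_snd) measurable_fst)]
    exact hφ.ae_eq_mk.mono fun x hx => hx.symm
  filter_upwards [hmk, ae_ae_condDistrib_id hφ hφ.ae_eq_mk] with y hy hφy
  filter_upwards [hy, hφy] with x hx hφx using hφx.trans hx

lemma aemeasurable_map_iff (hφ : AEMeasurable φ μ) {f : β → ℝ} :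
    AEMeasurable f (μ.map φ) ↔ AEMeasurable (fun x => f (φ x)) μ := by
  refine ⟨fun hf => hf.comp_aemeasurable hφ, fun ⟨h, hh, hfh⟩ =>
    ⟨fun y => ∫ x, h x ∂condDistrib id φ μ y,
      hh.stronglyMeasurable.integral_kernel.measurable, ?_⟩⟩
  filter_upwards [ae_ae_condDistrib_id hφ hfh, ae_map_ae_condDistrib_id_eq hφ] with y hy hfiber
  have hconst : h =ᵐ[condDistrib id φ μ y] fun _ => f y := by
    filter_upwards [hy, hfiber] with x hx hxy
    rw [← hx, hxy]
  simp [integral_congr_ae hconst]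

lemma lintegral_map_of_aemeasurable (hφ : AEMeasurable φ μ) (f : β → ℝ≥0∞) :
    ∫⁻ y, f y ∂μ.map φ = ∫⁻ x, f (φ x) ∂μ := by
  refine le_antisymm (lintegral_map_le f φ) ?_
  calc ∫⁻ x, f (φ x) ∂μ = ∫⁻ x, f (φ x) ∂(condDistrib id φ μ ∘ₘ μ.map φ) := by
        rw [condDistrib_id_comp_map hφ]
    _ ≤ ∫⁻ y, ∫⁻ x, f (φ x) ∂condDistrib id φ μ y ∂μ.map φ := Measure.lintegral_bind_le _ _ _
    _ = ∫⁻ y, f y ∂μ.map φ := by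
      refine lintegral_congr_ae ((ae_map_ae_condDistrib_id_eq hφ).mono fun y hy => ?_)
      have hconst : (fun x => f (φ x)) =ᵐ[condDistrib id φ μ y] fun _ => f y :=
        hy.mono fun x hx => congrArg f hx
      simp [lintegral_congr_ae hconst]

lemma memLp_map_iff_of_aemeasurable (hφ : AEMeasurable φ μ) (f : β → ℝ) (p : ℝ≥0∞) :
    MemLp f p (μ.map φ) ↔ MemLp (fun x => f (φ x)) p μ := by
  by_cases hf : AEMeasurable f (μ.map φ)
  · exact memLp_map_measure_iff hf.aestronglyMeasurable hφ
  · exact iff_of_false (fun h => hf h.1.aemeasurable)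
      fun h => hf ((aemeasurable_map_iff hφ).2 h.1.aemeasurable)

lemma variance_map_of_aemeasurable (hφ : AEMeasurable φ μ) (f : β → ℝ) :
    variance f (μ.map φ) = variance (fun x => f (φ x)) μ := by
  have hmean : ∫ y, f y ∂μ.map φ = ∫ x, f (φ x) ∂μ := by
    by_cases hf : AEMeasurable f (μ.map φ)
    · exact integral_map hφ hf.aestronglyMeasurable
    · rw [integral_non_aestronglyMeasurable fun h => hf h.aemeasurable,
        integral_non_aestronglyMeasurable fun h =>
          hf ((aemeasurable_map_iff hφ).2 h.aemeasurable)]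
  rw [variance, variance, evariance, evariance, hmean, lintegral_map_of_aemeasurable hφ]

end Pushforward

end ReactionCoordinate

theorem mainTheorem8_general {n r : ℕ} (X : Set (EuclideanSpace ℝ (Fin n)))
    (Z : Set (EuclideanSpace ℝ (Fin r))) (hX : NullMeasurableSet X)
    (π : EuclideanSpace ℝ (Fin n) → ℝ) (hπ : AEMeasurable π (volume.restrict X))
    (hμ : IsProbabilityMeasure (ReactionCoordinate.stationaryMeasure X π))
    (ξ : EuclideanSpace ℝ (Fin n) → EuclideanSpace ℝ (Fin r)) (hmaps : Set.MapsTo ξ X Z)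
    (hregular : ∀ᵐ x ∂volume.restrict X, Function.Surjective (fderiv ℝ ξ x))
    (f : EuclideanSpace ℝ (Fin r) → ℝ) (q : ℝ≥0∞) :
    IsProbabilityMeasure (ReactionCoordinate.effectiveMeasure X Z π ξ) ∧
    (MemLp (fun x => f (ξ x)) q (ReactionCoordinate.stationaryMeasure X π) ↔
      MemLp f q (ReactionCoordinate.effectiveMeasure X Z π ξ)) ∧
    ProbabilityTheory.variance (fun x => f (ξ x)) (ReactionCoordinate.stationaryMeasure X π) =
      ProbabilityTheory.variance f (ReactionCoordinate.effectiveMeasure X Z π ξ) := by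
  have hξ : AEMeasurable ξ (ReactionCoordinate.stationaryMeasure X π) :=
    ReactionCoordinate.aemeasurable_stationaryMeasure_of_ae_mem_regularSet hregular
  rw [← ReactionCoordinate.map_stationaryMeasure hX hπ hmaps hregular]
  exact ⟨Measure.isProbabilityMeasure_map hξ,
    (ReactionCoordinate.memLp_map_iff_of_aemeasurable hξ f q).symm,
    (ReactionCoordinate.variance_map_of_aemeasurable hξ f).symm⟩

theorem mainTheorem8 {n r : ℕ} (hr : r ≤ n)
    (X : Set (EuclideanSpace ℝ (Fin n))) (Z : Set (EuclideanSpace ℝ (Fin r)))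
    (hZ : MeasurableSet Z)
    (π : EuclideanSpace ℝ (Fin n) → ℝ)
    (p : ℝ → EuclideanSpace ℝ (Fin n) → EuclideanSpace ℝ (Fin n) → ℝ)
    (hsys : ReactionCoordinate.IsReversibleSystem X π p)
    (ξ ϑ : EuclideanSpace ℝ (Fin n) → EuclideanSpace ℝ (Fin r))
    (hξ : ReactionCoordinate.IsReactionCoordinate X Z ξ)
    (hϑ : ReactionCoordinate.IsReactionCoordinate X Z ϑ)
    (ε : ℝ≥0) (τ : ℝ)
    (pL : ℝ → EuclideanSpace ℝ (Fin r) → EuclideanSpace ℝ (Fin n) → ℝ)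
    (hL : ReactionCoordinate.IsLumpable X Z π p ξ ε τ pL) :
    IsProbabilityMeasure (ReactionCoordinate.effectiveMeasure X Z π ξ) ∧
    (MemLp (fun x => ReactionCoordinate.effectiveIntegrand X Z π ϑ (pL τ) (ξ x)) 2
        (ReactionCoordinate.stationaryMeasure X π) ↔
      MemLp (ReactionCoordinate.effectiveIntegrand X Z π ϑ (pL τ)) 2
        (ReactionCoordinate.effectiveMeasure X Z π ξ)) ∧
    ProbabilityTheory.variance
        (fun x => ReactionCoordinate.effectiveIntegrand X Z π ϑ (pL τ) (ξ x))
        (ReactionCoordinate.stationaryMeasure X π) =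
      ProbabilityTheory.variance (ReactionCoordinate.effectiveIntegrand X Z π ϑ (pL τ))
        (ReactionCoordinate.effectiveMeasure X Z π ξ) :=
  mainTheorem8_general X Z hsys.nullMeasurableSet π
    (hsys.continuousOn_density.aemeasurable₀ hsys.nullMeasurableSet) hsys.isProbabilityMeasure ξ
    hξ.mapsTo (hξ.regular.mono fun _ hx => hx.2) _ 2
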